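/- An \emph{automaton with delay blocks} (ADB) over an output alphabet $\Sigma$ is a tuple $\mathcal A=(Q,D,\Sigma,\delta,q_s,F)$ with a finite set $Q$ of locations, a starting location $q_s\in Q$, a set $F\subseteq Q$ of accepting locations, a finite set $D\subset\mathbb N$ of delays, and a transition function $\delta:(Q\times\Sigma\times D)\cup(Q\times\{\varepsilon,\mathsf{tick}\})\to 2^Q$, where $\mathsf{tick}\notin\Sigma$. A generating run is a finite sequence of transitions from $q_s$ to an accepting location. Time starts at $0$ and each $\mathsf{tick}$ transition of the run advances it by $1$; a symbol $\sigma$ generated by a transition labelled $(\sigma,d)$ at time $t$ receives the time stamp $t+d$. The run outputs the timed word in $(\Sigma\times\mathbb N)^*$ obtained by sorting the stamped symbols by time stamp, symbols with equal stamps keeping the order of their generation. The timed language $L(\mathcal A)$ is the set of timed words output by generating runs of $\mathcal A$, and the untimed language $U(\mathcal A)\subseteq\Sigma^*$ is obtained by erasing the time stamps. A timed (untimed) ADB language is a set of the form $L(\mathcal A)$ (of the form $U(\mathcal A)$). \textbf{Theorem (Closure properties).} Let $\Sigma$ be an alphabet. (1) If $U_1,U_2\subseteq\Sigma^*$ are untimed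 ADB languages and $R\subseteq\Sigma^*$ is a regular language, then $U_1\cup U_2$, $U_1U_2$, $U_1^*$ and $U_1\cap R$ are untimed ADB languages. (2) Let $\mathcal A_1,\mathcal A_2$ be ADBs over $\Sigma$ and let $M$ be the largest delay of $\mathcal A_1$ ($M=0$ if there is none). Take the disjoint union of $\mathcal A_1$, $\mathcal A_2$ and a path of $M$ consecutive $\mathsf{tick}$ transitions, add $\varepsilon$-transitions from every accepting location of $\mathcal A_1$ to the first location of the path and from the last location of the path to the starting location of $\mathcal A_2$; start in the starting location of $\mathcal A_1$ and accept in the accepting locations of $\mathcal A_2$. The untimed language of this ADB is $U(\mathcal A_1)U(\mathcal A_2)$. Likewise, take the disjoint union of $\mathcal A_1$ and a path of $M$ consecutive $\mathsf{tick}$ transitions, add $\varepsilon$-transitions from every accepting location of $\mathcal A_1$ to the first location of the path and from the last location of the path to the starting location of $\mathcal A_1$, and let the last location of the path be the starting location and the only accepting location. The untimed language of this ADB is $U(\mathcal A_1)^*$. (3) Let $a,b,\#\in\Sigma$ be three different symbols, let $\kappa_t(w)$ be the timed word in which every symbol of the word $w$ has time stamp $t$, let $$L^\dagger=\{\kappa_0(w\#)\,\kappa_1(w\#)\cdots\kappa_n(w\#)\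 :\ w\in\{a,b\}^*,\ n\ge 0\},$$ and let $U^\dagger=\{(w\#)^{n+1}: w\in\{a,b\}^*,\ n\ge 0\}$ be its untimed language. Then $L^\dagger$ is not a timed ADB language and $U^\dagger$ is not an untimed ADB language, but there are ADBs $\mathcal A_1,\mathcal A_2$ over $\Sigma$ with $L(\mathcal A_1)\cap L(\mathcal A_2)=L^\dagger$ and $U(\mathcal A_1)\cap U(\mathcal A_2)=U^\dagger$. In particular, if $\Sigma$ has at least three symbols, then the class of untimed ADB languages over $\Sigma$ is not closed under intersection. (4) If $\Sigma$ has at least three symbols, then the class of untimed ADB languages over $\Sigma$ is not closed under complementation in $\Sigma^*$. -/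

import Mathlib

/-- Labels of the transitions of an automaton with delay blocks over the output alphabet `S`:
`out s t` generates the symbol `s` through a delay block of delay `t`, `eps` is the empty label,
and `tick` lets one time unit pass. -/
inductive DelayLabel (S : Type*) where
  | out (s : S) (t : ℕ) : DelayLabel S
  | eps : DelayLabel S
  | tick : DelayLabel S

/-- A finite automaton with delay blocks (ADB) with output alphabet `S` and location set `Q`.
A delay block is identified with its delay. The transition function is defined on
`Q × S × delays` and on `Q × {eps, tick}`; this is expressed by requiring that `step` has no
successors for delays outside of `delays`. -/
structure ADB (S : Type*) (Q : Type*) where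
  finite_locations : Finite Q
  delays : Finset ℕ
  start : Q
  accept : Set Q
  step : Q → DelayLabel S → Set Q
  delay_mem : ∀ q s t q', q' ∈ step q (DelayLabel.out s t) → t ∈ delays

namespace ADB

/-- The symbols generated by a sequence of labels, in the order of generation, each with the time
at which it appears in the output: the time of its generation plus its delay. The first argument
is the current time. -/
def stamp {S : Type*} : ℕ → List (DelayLabel S) → List (S × ℕ)
  | _, [] => []
  | now, DelayLabel.out s t :: x => (s, now + t) :: stamp now x
  | now, DelayLabel.eps :: x => stamp now x
  | now, DelayLabel.tick :: x => stamp (now + 1) x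

/-- The timed output word of a sequence of labels: the stamped symbols are sorted by their time
stamps. Insertion sort is stable, so symbols with the same time stamp keep the order of their
generation. -/
def oword {S : Type*} (x : List (DelayLabel S)) : List (S × ℕ) :=
  (stamp 0 x).insertionSort (fun u v => u.2 ≤ v.2)

/-- The projection of a timed word onto the output alphabet. -/
def untime {S : Type*} (w : List (S × ℕ)) : List S := w.map Prod.fst

/-- The untimed language of a timed language. -/
def untimeLanguage {S : Type*} (T : Set (List (S × ℕ))) : Language S := untime '' T

/-- `A.Run q x q'`: there is a finite sequence of transitions of `A` from `q` to `q'` whose labels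
are, in order, the entries of `x`. -/
inductive Run {S Q : Type*} (A : ADB S Q) : Q → List (DelayLabel S) → Q → Prop
  | nil (q : Q) : Run A q [] q
  | cons {q q' q'' : Q} {l : DelayLabel S} {x : List (DelayLabel S)}
      (h : q' ∈ A.step q l) (r : Run A q' x q'') : Run A q (l :: x) q''

/-- The timed output language of `A`. -/
def timedLanguage {S Q : Type*} (A : ADB S Q) : Set (List (S × ℕ)) :=
  {w | ∃ x, ∃ q ∈ A.accept, A.Run A.start x q ∧ oword x = w}

/-- The untimed output language of `A`. -/
def untimedLanguage {S Q : Type*} (A : ADB S Q) : Language S :=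
  untimeLanguage A.timedLanguage

/-- The largest delay of a delay block of `A` (zero if `A` has no delay blocks). -/
def maxDelay {S Q : Type*} (A : ADB S Q) : ℕ := A.delays.sup id

/-- Transitions of the concatenation of `A₁` and `A₂`: the transitions of `A₁` and of `A₂`, and
a path of `M = A₁.maxDelay` padding `tick` transitions that can be entered silently from every
accepting location of `A₁` and be left silently to the starting location of `A₂`. -/
inductive ConcatStep {S Q₁ Q₂ : Type*} (A₁ : ADB S Q₁) (A₂ : ADB S Q₂) :
    Q₁ ⊕ Fin (A₁.maxDelay + 1) ⊕ Q₂ → DelayLabel S → Q₁ ⊕ Fin (A₁.maxDelay + 1) ⊕ Q₂ → Prop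
  | left {q q' : Q₁} {l : DelayLabel S} (h : q' ∈ A₁.step q l) :
      ConcatStep A₁ A₂ (Sum.inl q) l (Sum.inl q')
  | enter {q : Q₁} (h : q ∈ A₁.accept) :
      ConcatStep A₁ A₂ (Sum.inl q) DelayLabel.eps (Sum.inr (Sum.inl 0))
  | pad (i : Fin A₁.maxDelay) :
      ConcatStep A₁ A₂ (Sum.inr (Sum.inl i.castSucc)) DelayLabel.tick (Sum.inr (Sum.inl i.succ))
  | leave :
      ConcatStep A₁ A₂ (Sum.inr (Sum.inl (Fin.last _))) DelayLabel.eps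
        (Sum.inr (Sum.inr A₂.start))
  | right {q q' : Q₂} {l : DelayLabel S} (h : q' ∈ A₂.step q l) :
      ConcatStep A₁ A₂ (Sum.inr (Sum.inr q)) l (Sum.inr (Sum.inr q'))

/-- The concatenation of `A₁` and `A₂` with `A₁.maxDelay` padding `tick` transitions. -/
def concat {S Q₁ Q₂ : Type*} (A₁ : ADB S Q₁) (A₂ : ADB S Q₂) :
    ADB S (Q₁ ⊕ Fin (A₁.maxDelay + 1) ⊕ Q₂) where
  finite_locations := by
    have := A₁.finite_locations
    have := A₂.finite_locations
    infer_instance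
  delays := A₁.delays ∪ A₂.delays
  start := Sum.inl A₁.start
  accept := {p | ∃ q ∈ A₂.accept, p = Sum.inr (Sum.inr q)}
  step p l := {p' | ConcatStep A₁ A₂ p l p'}
  delay_mem := by
    rintro p s t p' h
    cases h with
    | left h => exact Finset.mem_union_left _ (A₁.delay_mem _ _ _ _ h)
    | right h => exact Finset.mem_union_right _ (A₂.delay_mem _ _ _ _ h)

/-- Transitions of the iteration of `A`: the transitions of `A`, and a path of `M = A.maxDelay`
padding `tick` transitions, which can be entered silently from every accepting location of `A`
and ends in the new starting location (the last location of the path), from which there is a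
silent transition to the starting location of `A`. -/
inductive StarStep {S Q : Type*} (A : ADB S Q) :
    Q ⊕ Fin (A.maxDelay + 1) → DelayLabel S → Q ⊕ Fin (A.maxDelay + 1) → Prop
  | inner {q q' : Q} {l : DelayLabel S} (h : q' ∈ A.step q l) :
      StarStep A (Sum.inl q) l (Sum.inl q')
  | enter {q : Q} (h : q ∈ A.accept) :
      StarStep A (Sum.inl q) DelayLabel.eps (Sum.inr 0)
  | pad (i : Fin A.maxDelay) :
      StarStep A (Sum.inr i.castSucc) DelayLabel.tick (Sum.inr i.succ)
  | restart :
      StarStep A (Sum.inr (Fin.last _)) DelayLabel.eps (Sum.inl A.start)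

/-- The iteration of `A` with `A.maxDelay` padding `tick` transitions. Its starting location is
its only accepting location. -/
def star {S Q : Type*} (A : ADB S Q) : ADB S (Q ⊕ Fin (A.maxDelay + 1)) where
  finite_locations := by
    have := A.finite_locations
    infer_instance
  delays := A.delays
  start := Sum.inr (Fin.last _)
  accept := {Sum.inr (Fin.last _)}
  step p l := {p' | StarStep A p l p'}
  delay_mem := by
    rintro p s t p' h
    cases h with
    | inner h => exact A.delay_mem _ _ _ _ h

/-- `κ_t(w)`: the timed word in which every symbol of `w` occurs at time `t`. -/
def kappa {S : Type*} (t : ℕ) (w : List S) : List (S × ℕ) := w.map (fun s => (s, t))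

/-- The timed language of all words `κ_0(w h) κ_1(w h) … κ_n(w h)` with `w ∈ {a, b}*` and
`n ≥ 0`. -/
def repeatedWords {S : Type*} (a b h : S) : Set (List (S × ℕ)) :=
  {x | ∃ (w : List S) (n : ℕ), (∀ s ∈ w, s = a ∨ s = b) ∧
    x = (List.range (n + 1)).flatMap (fun i => kappa i (w ++ [h]))}

end ADB

/-- `T` is the timed language of some ADB. -/
def IsTimedADBLanguage {S : Type*} (T : Set (List (S × ℕ))) : Prop :=
  ∃ (Q : Type) (A : ADB S Q), A.timedLanguage = T

/-- `L` is the untimed language of some ADB. -/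
def IsUntimedADBLanguage {S : Type*} (L : Language S) : Prop :=
  ∃ (Q : Type) (A : ADB S Q), A.untimedLanguage = L

open List

namespace ADB

/-! ### Stable sorting of timed words. -/

variable {S : Type*}

/-! Concatenation and star: after `M` padding ticks, all symbols of the first run are due no later
than anything generated next. The sort is stable, so ties do no harm and the output splits
(`uword_eq_append`).

Intersection with a regular language: at any time the pending symbols lie in `M + 1` time slots. A
DFA needs to know only the map on its states induced by the word in each slot, and there are
finitely many such maps. The product `inter` stores them, and `Run.of_inter` shows that the state
finally reached is invariant along runs.

Non-closure: sorting only permutes the generated symbols, and the words in generation order form a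
regular language. By pumping, a long word can lose a bounded nonempty part, up to permutation
(`exists_perm_append_mem_untimedLanguage`). For the repeated words, comparing length and number of
separators makes this impossible (`no_shorter_product`). Yet equality of all blocks is the
conjunction of two pairings, each of which couples disjoint pairs of neighbouring blocks. One ADB
handles a pairing by generating each letter twice, with delays 0 and 1. Erasing time stamps is
injective on block words, so the untimed intersection is the right one too. Complementation fails by
De Morgan and closure under union. -/

theorem orderedInsert_append_of_le {a : S × ℕ} {k l : List (S × ℕ)} (hl : ∀ u ∈ l, a.2 ≤ u.2) :
    (k ++ l).orderedInsert (fun u v => u.2 ≤ v.2) a =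
      k.orderedInsert (fun u v => u.2 ≤ v.2) a ++ l := by
  induction k with
  | nil => cases l <;> simp_all
  | cons b k ih =>
    by_cases hb : a.2 ≤ b.2
    · simp [hb]
    · simp [hb, ih]

theorem orderedInsert_append_of_lt {a : S × ℕ} {k l : List (S × ℕ)} (hk : ∀ u ∈ k, u.2 < a.2) :
    (k ++ l).orderedInsert (fun u v => u.2 ≤ v.2) a =
      k ++ l.orderedInsert (fun u v => u.2 ≤ v.2) a := by
  induction k with
  | nil => simp
  | cons b k ih =>
    have hb : ¬ a.2 ≤ b.2 := by simpa using hk b (by simp)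
    rw [cons_append, orderedInsert_cons, if_neg hb, ih fun u hu => hk u (by simp [hu]), cons_append]

/-- An inserted element goes in front of equal ones, so a non-strict inequality suffices. This is
why `M` padding ticks are enough, rather than `M + 1`. -/
theorem insertionSort_append_of_le {k l : List (S × ℕ)} (h : ∀ u ∈ k, ∀ v ∈ l, u.2 ≤ v.2) :
    (k ++ l).insertionSort (fun u v => u.2 ≤ v.2) =
      k.insertionSort (fun u v => u.2 ≤ v.2) ++ l.insertionSort (fun u v => u.2 ≤ v.2) := by
  induction k with
  | nil => simp
  | cons a k ih =>
    rw [cons_append, insertionSort_cons, ih fun u hu => h u (by simp [hu]),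
      orderedInsert_append_of_le, insertionSort_cons]
    intro u hu
    rw [mem_insertionSort] at hu
    exact h a (by simp) u hu

/-! ### Output words of label sequences. -/

/-- The timed output word of a sequence of labels that is started at time `now`. -/
def owordFrom (now : ℕ) (x : List (DelayLabel S)) : List (S × ℕ) :=
  (stamp now x).insertionSort (fun u v => u.2 ≤ v.2)

/-- The untimed output word of a sequence of labels. -/
def uword (x : List (DelayLabel S)) : List S := untime (oword x)

/-- The number of time units that pass during a sequence of labels. -/
def duration : List (DelayLabel S) → ℕ
  | [] => 0
  | DelayLabel.tick :: x => duration x + 1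
  | _ :: x => duration x

theorem stamp_append (t : ℕ) (x y : List (DelayLabel S)) :
    stamp t (x ++ y) = stamp t x ++ stamp (t + duration x) y := by
  induction x generalizing t with
  | nil => simp [stamp, duration]
  | cons l x ih => cases l <;> simp [duration, stamp, ih, Nat.add_comm, Nat.add_left_comm]

theorem stamp_add (t k : ℕ) (x : List (DelayLabel S)) :
    stamp (t + k) x = (stamp t x).map (fun u => (u.1, u.2 + k)) := by
  induction x generalizing t with
  | nil => rfl
  | cons l x ih => cases l <;> simp [stamp, ← ih, Nat.add_right_comm]

theorem le_of_mem_stamp {t : ℕ} {x : List (DelayLabel S)} {u : S × ℕ} (hu : u ∈ stamp t x) :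
    t ≤ u.2 := by
  induction x generalizing t with
  | nil => simp [stamp] at hu
  | cons l x ih =>
    cases l with
    | out s d =>
      rcases mem_cons.1 hu with rfl | hu
      · simp
      · exact ih hu
    | eps => exact ih hu
    | tick => exact (Nat.le_succ t).trans (ih hu)

/-- Shifting all stamps by a constant preserves their order and hence commutes with sorting. -/
theorem untime_owordFrom (t : ℕ) (x : List (DelayLabel S)) : untime (owordFrom t x) = uword x := by
  have h : owordFrom t x = (oword x).map (fun u => (u.1, u.2 + t)) := by
    rw [owordFrom, oword, ← Nat.zero_add t, stamp_add, Nat.zero_add]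
    exact (map_insertionSort (r := fun u v : S × ℕ => u.2 ≤ v.2)
      (s := fun u v : S × ℕ => u.2 ≤ v.2) _ _ (by simp)).symm
  simp [h, uword, untime]

theorem untime_append (v w : List (S × ℕ)) : untime (v ++ w) = untime v ++ untime w :=
  map_append

theorem uword_perm (x : List (DelayLabel S)) : uword x ~ untime (stamp 0 x) :=
  (perm_insertionSort _ _).map _

/-- Padding: if `z` generates `x` followed by `y`, and `y` is generated at a time at which all
symbols of `x` have been output, then the output is the concatenation of the two outputs. -/
theorem uword_eq_append {M : ℕ} {x y z : List (DelayLabel S)}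
    (hx : ∀ u ∈ stamp 0 x, u.2 ≤ duration x + M)
    (h : stamp 0 z = stamp 0 x ++ stamp (duration x + M) y) : uword z = uword x ++ uword y := by
  rw [← untime_owordFrom (duration x + M) y, uword, uword, ← untime_append, oword, h,
    insertionSort_append_of_le fun u hu v hv => (hx u hu).trans (le_of_mem_stamp hv)]
  rfl

theorem uword_congr {t : ℕ} {x y : List (DelayLabel S)} (h : stamp 0 x = stamp t y) :
    uword x = uword y := by
  rw [← untime_owordFrom t y, uword, oword, h, owordFrom]

/-! ### Runs and the untimed language. -/

variable {Q : Type*}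

theorem Run.append {A : ADB S Q} {p q r : Q} {x y : List (DelayLabel S)} (h : A.Run p x q)
    (h' : A.Run q y r) : A.Run p (x ++ y) r := by
  induction h with
  | nil => exact h'
  | cons hs _ ih => exact .cons hs (ih h')

theorem le_maxDelay {A : ADB S Q} {p q : Q} {s : S} {d : ℕ} (h : q ∈ A.step p (.out s d)) :
    d ≤ A.maxDelay :=
  Finset.le_sup (f := id) (A.delay_mem _ _ _ _ h)

theorem Run.stamp_le {A : ADB S Q} {p q : Q} {x : List (DelayLabel S)} (h : A.Run p x q) {t : ℕ}
    {u : S × ℕ} (hu : u ∈ stamp t x) : u.2 ≤ t + duration x + A.maxDelay := by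
  induction h generalizing t with
  | nil => simp [stamp] at hu
  | @cons _ _ _ l x hs _ ih =>
    cases l with
    | out s d =>
      rcases mem_cons.1 hu with rfl | hu
      · have := le_maxDelay hs
        simp only
        omega
      · exact ih hu
    | eps => exact ih hu
    | tick =>
      have := ih hu
      rw [duration]
      omega

theorem mem_untimedLanguage {A : ADB S Q} {w : List S} :
    w ∈ A.untimedLanguage ↔ ∃ x, ∃ q ∈ A.accept, A.Run A.start x q ∧ uword x = w := by
  constructor
  · rintro ⟨_, ⟨x, q, hq, hr, rfl⟩, rfl⟩
    exact ⟨x, q, hq, hr, rfl⟩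
  · rintro ⟨x, q, hq, hr, rfl⟩
    exact ⟨_, ⟨x, q, hq, hr, rfl⟩, rfl⟩

theorem Run.map {Q' : Type*} {A : ADB S Q} {B : ADB S Q'} (f : Q → Q')
    (hf : ∀ p l q, q ∈ A.step p l → f q ∈ B.step (f p) l) {p q : Q} {x : List (DelayLabel S)}
    (h : A.Run p x q) : B.Run (f p) x (f q) := by
  induction h with
  | nil => exact .nil _
  | cons hs _ ih => exact .cons (hf _ _ _ hs) ih

/-! ### Union. -/

section union

variable {Q₁ Q₂ : Type*}

/-- Transitions of the union of `A₁` and `A₂`: a new starting location `none` with silent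
transitions to the two starting locations. -/
inductive UnionStep (A₁ : ADB S Q₁) (A₂ : ADB S Q₂) :
    Option (Q₁ ⊕ Q₂) → DelayLabel S → Option (Q₁ ⊕ Q₂) → Prop
  | startLeft : UnionStep A₁ A₂ none .eps (some (.inl A₁.start))
  | startRight : UnionStep A₁ A₂ none .eps (some (.inr A₂.start))
  | left {q q' : Q₁} {l : DelayLabel S} (h : q' ∈ A₁.step q l) :
      UnionStep A₁ A₂ (some (.inl q)) l (some (.inl q'))
  | right {q q' : Q₂} {l : DelayLabel S} (h : q' ∈ A₂.step q l) :
      UnionStep A₁ A₂ (some (.inr q)) l (some (.inr q'))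

/-- An ADB for the union. -/
def union (A₁ : ADB S Q₁) (A₂ : ADB S Q₂) : ADB S (Option (Q₁ ⊕ Q₂)) where
  finite_locations := by
    have := A₁.finite_locations
    have := A₂.finite_locations
    infer_instance
  delays := A₁.delays ∪ A₂.delays
  start := none
  accept := {p | (∃ q ∈ A₁.accept, p = some (.inl q)) ∨ ∃ q ∈ A₂.accept, p = some (.inr q)}
  step p l := {p' | UnionStep A₁ A₂ p l p'}
  delay_mem := by
    rintro p s t p' h
    cases h with
    | left h => exact Finset.mem_union_left _ (A₁.delay_mem _ _ _ _ h)
    | right h => exact Finset.mem_union_right _ (A₂.delay_mem _ _ _ _ h)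

theorem Run.of_union {A₁ : ADB S Q₁} {A₂ : ADB S Q₂} {p p' : Option (Q₁ ⊕ Q₂)}
    {x : List (DelayLabel S)} (h : (A₁.union A₂).Run p x p') :
    (∀ q, p = some (.inl q) → ∃ q', p' = some (.inl q') ∧ A₁.Run q x q') ∧
      ∀ q, p = some (.inr q) → ∃ q', p' = some (.inr q') ∧ A₂.Run q x q' := by
  induction h with
  | nil => exact ⟨fun q hq => ⟨q, hq, .nil _⟩, fun q hq => ⟨q, hq, .nil _⟩⟩
  | cons hs _ ih =>
    constructor
    · rintro q rfl
      cases hs with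
      | left hs =>
        obtain ⟨q', h, hr⟩ := ih.1 _ rfl
        exact ⟨q', h, .cons hs hr⟩
    · rintro q rfl
      cases hs with
      | right hs =>
        obtain ⟨q', h, hr⟩ := ih.2 _ rfl
        exact ⟨q', h, .cons hs hr⟩

theorem untimedLanguage_union (A₁ : ADB S Q₁) (A₂ : ADB S Q₂) :
    (A₁.union A₂).untimedLanguage = A₁.untimedLanguage + A₂.untimedLanguage := by
  ext w
  rw [Language.mem_add, mem_untimedLanguage, mem_untimedLanguage, mem_untimedLanguage]
  constructor
  · rintro ⟨x, p, hp, hr, rfl⟩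
    have hp' : p ≠ none := by
      rintro rfl
      simp [union] at hp
    generalize hs : (A₁.union A₂).start = p₀ at hr
    cases hr with
    | nil => exact absurd hs.symm hp'
    | cons h hr =>
      obtain rfl : none = p₀ := hs
      cases h with
      | startLeft =>
        obtain ⟨q, rfl, hr'⟩ := hr.of_union.1 _ rfl
        exact Or.inl ⟨_, q, by simpa [union] using hp, hr', rfl⟩
      | startRight =>
        obtain ⟨q, rfl, hr'⟩ := hr.of_union.2 _ rfl
        exact Or.inr ⟨_, q, by simpa [union] using hp, hr', rfl⟩
  · rintro (⟨x, q, hq, hr, rfl⟩ | ⟨x, q, hq, hr, rfl⟩)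
    · exact ⟨.eps :: x, _, Or.inl ⟨q, hq, rfl⟩,
        .cons UnionStep.startLeft (hr.map (B := A₁.union A₂) (fun q => some (.inl q))
          fun _ _ _ h => UnionStep.left h), rfl⟩
    · exact ⟨.eps :: x, _, Or.inr ⟨q, hq, rfl⟩,
        .cons UnionStep.startRight (hr.map (B := A₁.union A₂) (fun q => some (.inr q))
          fun _ _ _ h => UnionStep.right h), rfl⟩

end union

/-! ### Concatenation and iteration with padding ticks. -/

theorem stamp_replicate_tick_append (t k : ℕ) (x : List (DelayLabel S)) :
    stamp t (replicate k .tick ++ x) = stamp (t + k) x := by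
  induction k generalizing t with
  | zero => rfl
  | succ k ih => rw [replicate_succ, cons_append, stamp, ih, Nat.add_right_comm, Nat.add_assoc]

/-- A run along a path of `tick` transitions. -/
theorem Run.of_path {A : ADB S Q} {n : ℕ} (f : Fin (n + 1) → Q)
    (hf : ∀ i : Fin n, f i.succ ∈ A.step (f i.castSucc) .tick) :
    A.Run (f 0) (replicate n .tick) (f (Fin.last n)) := by
  induction n with
  | zero => exact .nil _
  | succ n ih => exact .cons (hf 0) (ih (fun i => f i.succ) fun i => hf i.succ)

section concat

variable {Q₁ Q₂ : Type*} {A₁ : ADB S Q₁} {A₂ : ADB S Q₂}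

/-- There is one clause per component, since the induction goes backwards from the end of the run.
From position `i` of the path `M - i` ticks remain, which delays the second run by that amount. Only
stamps are compared, so the silent connecting transitions disappear. -/
theorem Run.of_concat {p p' : Q₁ ⊕ Fin (A₁.maxDelay + 1) ⊕ Q₂} {x : List (DelayLabel S)}
    (h : (A₁.concat A₂).Run p x p') {r : Q₂} (hr : p' = .inr (.inr r)) :
    (∀ q, p = .inr (.inr q) → A₂.Run q x r) ∧
    (∀ i : Fin (A₁.maxDelay + 1), p = .inr (.inl i) → ∃ y, A₂.Run A₂.start y r ∧
      ∀ t, stamp t x = stamp (t + (A₁.maxDelay - i)) y) ∧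
    (∀ q, p = .inl q → ∃ x₁, ∃ q₁ ∈ A₁.accept, ∃ y, A₁.Run q x₁ q₁ ∧ A₂.Run A₂.start y r ∧
      ∀ t, stamp t x = stamp t x₁ ++ stamp (t + (duration x₁ + A₁.maxDelay)) y) := by
  induction h with
  | nil =>
    subst hr
    exact ⟨by rintro q ⟨⟩; exact .nil _, by rintro _ ⟨⟩, by rintro _ ⟨⟩⟩
  | @cons _ _ _ l _ hs _ ih =>
    obtain ⟨ih₁, ih₂, ih₃⟩ := ih hr
    refine ⟨?_, ?_, ?_⟩
    · rintro q rfl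
      cases hs with
      | right hs => exact .cons hs (ih₁ _ rfl)
    · rintro i rfl
      cases hs with
      | pad i =>
        obtain ⟨y, hy, h⟩ := ih₂ _ rfl
        refine ⟨y, hy, fun t => ?_⟩
        have : t + 1 + (A₁.maxDelay - (i + 1)) = t + (A₁.maxDelay - i) := by omega
        simp [stamp, h, this]
      | leave => exact ⟨_, ih₁ _ rfl, fun t => by simp [stamp]⟩
    · rintro q rfl
      cases hs with
      | enter hq =>
        obtain ⟨y, hy, h⟩ := ih₂ _ rfl
        exact ⟨[], q, hq, y, .nil _, hy, fun t => by simp [stamp, duration, h]⟩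
      | left hs =>
        obtain ⟨x₁, q₁, hq₁, y, hx₁, hy, h⟩ := ih₃ _ rfl
        refine ⟨l :: x₁, q₁, hq₁, y, .cons hs hx₁, hy, fun t => ?_⟩
        cases l <;> simp [stamp, duration, h, Nat.add_comm, Nat.add_left_comm, Nat.add_assoc]

theorem untimedLanguage_concat (A₁ : ADB S Q₁) (A₂ : ADB S Q₂) :
    (A₁.concat A₂).untimedLanguage = A₁.untimedLanguage * A₂.untimedLanguage := by
  ext w
  simp only [Language.mem_mul, mem_untimedLanguage]
  constructor
  · rintro ⟨x, _, ⟨r, hr, rfl⟩, hx, rfl⟩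
    obtain ⟨x₁, q₁, hq₁, y, hx₁, hy, h⟩ := (hx.of_concat rfl).2.2 _ rfl
    exact ⟨_, ⟨x₁, q₁, hq₁, hx₁, rfl⟩, _, ⟨y, r, hr, hy, rfl⟩,
      (uword_eq_append (fun u hu => by simpa using hx₁.stamp_le hu) (by simpa using h 0)).symm⟩
  · rintro ⟨_, ⟨x, q, hq, hx, rfl⟩, _, ⟨y, r, hr, hy, rfl⟩, rfl⟩
    refine ⟨x ++ (.eps :: (replicate A₁.maxDelay .tick ++ .eps :: y)), _, ⟨r, hr, rfl⟩,
      (hx.map (B := A₁.concat A₂) Sum.inl fun _ _ _ h => ConcatStep.left h).append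
        (.cons (ConcatStep.enter hq)
          ((Run.of_path (A := A₁.concat A₂) (fun i => Sum.inr (Sum.inl i)) fun i => ConcatStep.pad i).append
            (.cons ConcatStep.leave
              (hy.map (B := A₁.concat A₂) (fun q => Sum.inr (Sum.inr q)) fun _ _ _ h => ConcatStep.right h)))),
      uword_eq_append (M := A₁.maxDelay) (fun u hu => by simpa using hx.stamp_le hu) ?_⟩
    rw [stamp_append, Nat.zero_add]
    simp [stamp, stamp_replicate_tick_append]

end concat

section star

variable {A : ADB S Q}

/-- As for concatenation, but the remainder `y` need not be recorded as a run: it matters only that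
its output lies in the star. -/
theorem Run.of_star {p p' : Q ⊕ Fin (A.maxDelay + 1)} {x : List (DelayLabel S)}
    (h : A.star.Run p x p') (hp' : p' = .inr (Fin.last _)) :
    (∀ i : Fin (A.maxDelay + 1), p = .inr i → ∃ y, uword y ∈ KStar.kstar A.untimedLanguage ∧
      ∀ t, stamp t x = stamp (t + (A.maxDelay - i)) y) ∧
    (∀ q, p = .inl q → ∃ x₁, ∃ q₁ ∈ A.accept, ∃ y, A.Run q x₁ q₁ ∧
      uword y ∈ KStar.kstar A.untimedLanguage ∧
      ∀ t, stamp t x = stamp t x₁ ++ stamp (t + (duration x₁ + A.maxDelay)) y) := by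
  induction h with
  | nil =>
    subst hp'
    exact ⟨by rintro q ⟨⟩; exact ⟨[], Language.nil_mem_kstar _, fun t => rfl⟩, by rintro _ ⟨⟩⟩
  | @cons _ _ _ l x hs _ ih =>
    obtain ⟨ih₂, ih₃⟩ := ih hp'
    refine ⟨?_, ?_⟩
    · rintro i rfl
      cases hs with
      | pad i =>
        obtain ⟨y, hy, h⟩ := ih₂ _ rfl
        refine ⟨y, hy, fun t => ?_⟩
        have : t + 1 + (A.maxDelay - (i + 1)) = t + (A.maxDelay - i) := by omega
        simp [stamp, h, this]
      | restart =>
        obtain ⟨x₁, q₁, hq₁, y, hx₁, hy, h⟩ := ih₃ _ rfl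
        -- At the last location of the path no tick remains, so the rest of the run itself serves as
        -- `y`; its first round is split off by padding.
        refine ⟨x, ?_, fun t => by simp [stamp]⟩
        rw [uword_eq_append (fun u hu => by simpa using hx₁.stamp_le hu) (by simpa using h 0),
          ← Language.one_add_self_mul_kstar_eq_kstar, Language.mem_add]
        exact Or.inr (Language.append_mem_mul
          (mem_untimedLanguage.2 ⟨_, _, hq₁, hx₁, rfl⟩) hy)
    · rintro q rfl
      cases hs with
      | enter hq =>
        obtain ⟨y, hy, h⟩ := ih₂ _ rfl
        exact ⟨[], q, hq, y, .nil _, hy, fun t => by simp [stamp, duration, h]⟩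
      | inner hs =>
        obtain ⟨x₁, q₁, hq₁, y, hx₁, hy, h⟩ := ih₃ _ rfl
        refine ⟨l :: x₁, q₁, hq₁, y, .cons hs hx₁, hy, fun t => ?_⟩
        cases l <;> simp [stamp, duration, h, Nat.add_comm, Nat.add_left_comm, Nat.add_assoc]

theorem untimedLanguage_star (A : ADB S Q) :
    A.star.untimedLanguage = KStar.kstar A.untimedLanguage := by
  ext w
  constructor
  · rw [mem_untimedLanguage]
    rintro ⟨x, _, rfl, hx, rfl⟩
    obtain ⟨y, hy, h⟩ := (hx.of_star rfl).1 _ rfl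
    rwa [uword_congr (h 0)]
  · rw [Language.mem_kstar]
    rintro ⟨ws, rfl, hws⟩
    rw [mem_untimedLanguage]
    suffices ∃ x, A.star.Run (Sum.inr (Fin.last _)) x (Sum.inr (Fin.last _)) ∧
        uword x = ws.flatten by
      obtain ⟨x, hx, h⟩ := this
      exact ⟨x, _, rfl, hx, h⟩
    induction ws with
    | nil => exact ⟨[], .nil _, rfl⟩
    | cons w ws ih =>
      obtain ⟨x, q, hq, hx, rfl⟩ := mem_untimedLanguage.1 (hws w (by simp))
      obtain ⟨y, hy, h⟩ := ih fun y hy => hws y (by simp [hy])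
      refine ⟨.eps :: (x ++ (.eps :: (replicate A.maxDelay .tick ++ y))),
        .cons StarStep.restart
          ((hx.map (B := A.star) Sum.inl fun _ _ _ h => StarStep.inner h).append
            (.cons (StarStep.enter hq)
              ((Run.of_path (A := A.star) (fun i => Sum.inr i) fun i => StarStep.pad i).append hy))), ?_⟩
      rw [flatten_cons, ← h]
      refine uword_eq_append (M := A.maxDelay) (fun u hu => by simpa using hx.stamp_le hu) ?_
      rw [stamp, stamp_append, Nat.zero_add]
      simp [stamp, stamp_replicate_tick_append]

end star

/-! ### Intersection with regular languages. -/

variable {σ : Type*}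

/-- The value of a DFA on the sorted word of those symbols of `l` with a time stamp in
`t, …, t + n - 1`, where the symbols with time stamp `t + i` are preceded by a word that acts on
the states as `f i`. -/
def slotEval (D : DFA S σ) : ℕ → ℕ → (ℕ → σ → σ) → σ → List (S × ℕ) → σ
  | 0, _, _, r, _ => r
  | n + 1, t, f, r, l => slotEval D n (t + 1) (fun i => f (i + 1))
      (D.evalFrom (f 0 r) (untime (l.filter fun u => u.2 = t))) l

theorem slotEval_nil (D : DFA S σ) (n t t' : ℕ) (f : ℕ → σ → σ) (r : σ) :
    slotEval D n t f r [] = slotEval D n t' f r [] := by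
  induction n generalizing t t' f r with
  | zero => rfl
  | succ n ih => exact ih ..

/-- A symbol with a time stamp before `t` is ignored. -/
theorem slotEval_cons_of_lt (D : DFA S σ) {n t t' : ℕ} (h : t' < t) (f : ℕ → σ → σ) (r : σ) (c : S)
    (l : List (S × ℕ)) : slotEval D n t f r ((c, t') :: l) = slotEval D n t f r l := by
  induction n generalizing t f r with
  | zero => rfl
  | succ n ih => simp [slotEval, ih (h.trans t.lt_succ_self), h.ne]

/-- The first symbol of a list can be moved to the word preceding its time stamp. -/
theorem slotEval_cons (D : DFA S σ) {n d : ℕ} (hd : d < n) (t : ℕ) (f : ℕ → σ → σ) (r : σ) (c : S)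
    (l : List (S × ℕ)) :
    slotEval D n t f r ((c, t + d) :: l) =
      slotEval D n t (Function.update f d fun p => D.step (f d p) c) r l := by
  induction n generalizing t f r d with
  | zero => omega
  | succ n ih =>
    cases d with
    | zero =>
      have : (fun i => Function.update f 0 (fun p => D.step (f 0 p) c) (i + 1)) =
          fun i => f (i + 1) := by
        ext i; simp
      simp only [slotEval, this]
      rw [slotEval_cons_of_lt D (by omega)]
      simp [untime]
    | succ d =>
      have : (fun i => Function.update f (d + 1) (fun p => D.step (f (d + 1) p) c) (i + 1)) =
          Function.update (fun i => f (i + 1)) d fun p => D.step (f (d + 1) p) c := by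
        ext i
        by_cases h : i = d <;> simp [Function.update, h]
      have h' : t + (d + 1) = t + 1 + d := by omega
      simp only [slotEval, this]
      rw [h', ih (by omega)]
      simp [show t + 1 + d ≠ t by omega]

/-- By stability, the symbols of the earliest slot come first and in generation order. This peels
off one slot at a time, matching the recursion of `slotEval`. -/
theorem insertionSort_filter_le (t : ℕ) (l : List (S × ℕ)) :
    (l.filter fun u => t ≤ u.2).insertionSort (fun u v => u.2 ≤ v.2) =
      (l.filter fun u => u.2 = t) ++
        (l.filter fun u => t + 1 ≤ u.2).insertionSort (fun u v => u.2 ≤ v.2) := by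
  induction l with
  | nil => rfl
  | cons a l ih =>
    rcases lt_trichotomy a.2 t with h | h | h
    · simpa [h.ne, h.not_ge, show ¬ t < a.2 by omega] using ih
    · rw [filter_cons_of_pos (by simp [h]), filter_cons_of_pos (by simp [h]),
        filter_cons_of_neg (by simp [h]), insertionSort_cons_of_forall_rel, ih, cons_append]
      intro u hu
      simp only [mem_filter, decide_eq_true_eq] at hu
      omega
    · rw [filter_cons_of_pos (by simp [h.le]), filter_cons_of_neg (by simp [h.ne']),
        filter_cons_of_pos (by simpa using h), insertionSort_cons, ih,
        orderedInsert_append_of_lt, insertionSort_cons]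
      intro u hu
      simp only [mem_filter, decide_eq_true_eq] at hu
      omega

theorem slotEval_id (D : DFA S σ) (n t : ℕ) (r : σ) (l : List (S × ℕ))
    (hl : ∀ u ∈ l, u.2 < t + n) :
    slotEval D n t (fun _ => id) r l = D.evalFrom r (untime
      ((l.filter fun u => t ≤ u.2).insertionSort (fun u v => u.2 ≤ v.2))) := by
  induction n generalizing t r with
  | zero =>
    have : (l.filter fun u => t ≤ u.2) = [] := by
      simpa [filter_eq_nil_iff] using hl
    rw [this]
    rfl
  | succ n ih =>
    rw [insertionSort_filter_le, untime_append, DFA.evalFrom_of_append, slotEval,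
      ih _ _ fun u hu => by have := hl u hu; omega]
    rfl

/-- The product of an ADB with a DFA. A location consists of a location of `A`, the actions on the
states of the DFA of the words waiting for output at the current and at later times, and the state
reached by the DFA on the output before the current time. -/
def inter (A : ADB S Q) (D : DFA S σ) [Finite σ] :
    ADB S (Q × {f : ℕ → σ → σ // ∀ i, A.maxDelay < i → f i = id} × σ) where
  finite_locations := by
    have := A.finite_locations
    have : Finite {f : ℕ → σ → σ // ∀ i, A.maxDelay < i → f i = id} := by
      -- The identity condition beyond the largest delay leaves `M + 1` self-maps of a finite set to
      -- choose.
      refine Finite.of_injective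
        (fun f => fun i : Fin (A.maxDelay + 1) => f.1 i) fun f g hfg => Subtype.ext ?_
      ext1 i
      rcases Nat.lt_or_ge A.maxDelay i with h | h
      · rw [f.2 i h, g.2 i h]
      · exact congrFun hfg ⟨i, Nat.lt_succ_of_le h⟩
    infer_instance
  delays := A.delays
  start := (A.start, ⟨fun _ => id, fun _ _ => rfl⟩, D.start)
  -- At the end of a run, the pending actions of all `M + 1` slots are applied in order; the time
  -- `0` is arbitrary because the list is empty.
  accept := {p | p.1 ∈ A.accept ∧
    slotEval D (A.maxDelay + 1) 0 p.2.1.1 p.2.2 [] ∈ D.accept}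
  step p l := {p' | p'.1 ∈ A.step p.1 l ∧ match l with
    | .out c d => p'.2.1.1 = Function.update p.2.1.1 d (fun r => D.step (p.2.1.1 d r) c) ∧
        p'.2.2 = p.2.2
    | .eps => p'.2 = p.2
    | .tick => p'.2.1.1 = (fun i => p.2.1.1 (i + 1)) ∧ p'.2.2 = p.2.1.1 0 p.2.2}
  delay_mem _ _ _ _ h := A.delay_mem _ _ _ _ h.1

/-- Invariant: evaluating the stored actions together with the symbols still to be generated gives
the same DFA state all along the run. The window reaches the latest possible stamp, and each tick
closes one slot. -/
theorem Run.of_inter {A : ADB S Q} {D : DFA S σ} [Finite σ] {p p'} {x : List (DelayLabel S)}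
    (h : (A.inter D).Run p x p') (t : ℕ) :
    A.Run p.1 x p'.1 ∧
      slotEval D (duration x + A.maxDelay + 1) t p.2.1.1 p.2.2 (stamp t x) =
        slotEval D (A.maxDelay + 1) 0 p'.2.1.1 p'.2.2 [] := by
  induction h generalizing t with
  | nil => exact ⟨.nil _, by simpa [duration, stamp] using slotEval_nil ..⟩
  | @cons p q _ l x hs _ ih =>
    obtain ⟨hq, hs⟩ := hs
    cases l with
    | out c d =>
      obtain ⟨hr, ih⟩ := ih t
      have := le_maxDelay hq
      refine ⟨.cons hq hr, ?_⟩
      rw [← ih, stamp, duration, slotEval_cons D (by omega), hs.1, hs.2]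
      nofun
    | eps =>
      obtain ⟨hr, ih⟩ := ih t
      refine ⟨.cons hq hr, ?_⟩
      rw [← ih, hs]
      rfl
    | tick =>
      obtain ⟨hr, ih⟩ := ih (t + 1)
      refine ⟨.cons hq hr, ?_⟩
      -- After the tick nothing can enter slot `t`, so its stored action is final and can be
      -- applied.
      have : (stamp (t + 1) x).filter (fun u => u.2 = t) = [] := by
        rw [filter_eq_nil_iff]
        intro u hu
        have := le_of_mem_stamp hu
        simp
        omega
      rw [← ih, hs.1, hs.2, stamp, duration, Nat.add_right_comm, Nat.add_right_comm _ 1, slotEval,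
        this, Nat.add_right_comm]
      rfl

/-- The memory never blocks a transition: delays are at most `M`, so its updates respect the
identity condition. -/
theorem Run.exists_inter {A : ADB S Q} (D : DFA S σ) [Finite σ] {q q' : Q}
    {x : List (DelayLabel S)} (h : A.Run q x q') (m) : ∃ m', (A.inter D).Run (q, m) x (q', m') := by
  induction h generalizing m with
  | nil => exact ⟨m, .nil _⟩
  | @cons _ _ _ l _ hs _ ih =>
    obtain ⟨m₁, h₁⟩ : ∃ m₁, (_, m₁) ∈ (A.inter D).step (_, m) l := by
      cases l with
      | out c d =>
        refine ⟨(⟨Function.update m.1.1 d fun r => D.step (m.1.1 d r) c, fun i hi => ?_⟩, _),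
          hs, rfl, rfl⟩
        have : d ≤ A.maxDelay := le_maxDelay hs
        rw [Function.update_of_ne (by omega)]
        exact m.1.2 i hi
      | eps => exact ⟨_, hs, rfl⟩
      | tick => exact ⟨(⟨_, fun i hi => m.1.2 (i + 1) (hi.trans i.lt_succ_self)⟩, _), hs, rfl, rfl⟩
    obtain ⟨m', h'⟩ := ih m₁
    exact ⟨m', .cons h₁ h'⟩

theorem untimedLanguage_inter (A : ADB S Q) (D : DFA S σ) [Finite σ] :
    (A.inter D).untimedLanguage = A.untimedLanguage ⊓ D.accepts := by
  have key : ∀ x p', (A.inter D).Run (A.inter D).start x p' → A.Run A.start x p'.1 ∧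
      (uword x ∈ D.accepts ↔
        slotEval D (A.maxDelay + 1) 0 p'.2.1.1 p'.2.2 [] ∈ D.accept) := by
    intro x p' h
    obtain ⟨hr, he⟩ := h.of_inter 0
    refine ⟨hr, ?_⟩
    rw [← he, inter, slotEval_id, DFA.mem_accepts, DFA.eval]
    · simp [uword, oword]
    · intro u hu
      have := hr.stamp_le hu
      omega
  ext w
  rw [Language.mem_inf, mem_untimedLanguage, mem_untimedLanguage]
  constructor
  · rintro ⟨x, p', ⟨hp, hp'⟩, h, rfl⟩
    obtain ⟨hr, he⟩ := key _ _ h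
    exact ⟨⟨x, _, hp, hr, rfl⟩, he.2 hp'⟩
  · rintro ⟨⟨x, q, hq, h, rfl⟩, hw⟩
    obtain ⟨m', h'⟩ := h.exists_inter D (A.inter D).start.2
    exact ⟨x, _, ⟨hq, (key _ _ h').2.1 hw⟩, h', rfl⟩

/-! ### Pumping up to permutation. -/

/-- The automaton that accepts the symbols generated by the runs of `A`, in the order of their
generation. -/
def generator (A : ADB S Q) : εNFA S Q where
  step q l := match l with
    | some s => {q' | ∃ d, q' ∈ A.step q (.out s d)}
    | none => A.step q .eps ∪ A.step q .tick
  start := {A.start}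
  accept := A.accept

theorem untime_cons (u : S × ℕ) (w : List (S × ℕ)) : untime (u :: w) = u.1 :: untime w := rfl

theorem Run.isPath_generator {A : ADB S Q} {p q : Q} {x : List (DelayLabel S)} (h : A.Run p x q)
    (t : ℕ) : ∃ y, y.reduceOption = untime (stamp t x) ∧ A.generator.IsPath p q y := by
  induction h generalizing t with
  | nil => exact ⟨[], rfl, .nil _⟩
  | @cons _ _ _ l _ hs _ ih =>
    cases l with
    | out s d =>
      obtain ⟨y, hy, h⟩ := ih t
      exact ⟨some s :: y, by simp [hy, stamp, untime_cons], .cons _ _ _ _ _ ⟨d, hs⟩ h⟩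
    | eps =>
      obtain ⟨y, hy, h⟩ := ih t
      exact ⟨none :: y, by simpa [stamp] using hy, .cons _ _ _ _ _ (Or.inl hs) h⟩
    | tick =>
      obtain ⟨y, hy, h⟩ := ih (t + 1)
      exact ⟨none :: y, by simpa [stamp] using hy, .cons _ _ _ _ _ (Or.inr hs) h⟩

theorem exists_run_of_isPath_generator {A : ADB S Q} {p q : Q} {y : List (Option S)}
    (h : A.generator.IsPath p q y) (t : ℕ) :
    ∃ x, untime (stamp t x) = y.reduceOption ∧ A.Run p x q := by
  induction h generalizing t with
  | nil => exact ⟨[], rfl, .nil _⟩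
  | cons _ _ _ l _ hs _ ih =>
    cases l with
    | some s =>
      obtain ⟨d, hs⟩ := hs
      obtain ⟨x, hx, h⟩ := ih t
      exact ⟨.out s d :: x, by simp [hx, stamp, untime_cons], .cons hs h⟩
    | none =>
      rcases hs with hs | hs
      · obtain ⟨x, hx, h⟩ := ih t
        exact ⟨.eps :: x, by simpa [stamp] using hx, .cons hs h⟩
      · obtain ⟨x, hx, h⟩ := ih (t + 1)
        exact ⟨.tick :: x, by simpa [stamp] using hx, .cons hs h⟩

/-- Up to the order of the symbols, the untimed language of an ADB is regular. -/
theorem exists_perm_mem_untimedLanguage {A : ADB S Q} {v : List S} (hv : v ∈ A.generator.accepts) :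
    ∃ w ∈ A.untimedLanguage, w ~ v := by
  obtain ⟨_, q, y, rfl, hq, rfl, h⟩ := (εNFA.mem_accepts_iff_exists_path _).1 hv
  obtain ⟨x, hx, h⟩ := exists_run_of_isPath_generator h 0
  exact ⟨_, mem_untimedLanguage.2 ⟨x, q, hq, h, rfl⟩, hx ▸ uword_perm x⟩

theorem exists_perm_mem_generator {A : ADB S Q} {w : List S} (hw : w ∈ A.untimedLanguage) :
    ∃ v ∈ A.generator.accepts, w ~ v := by
  obtain ⟨x, q, hq, h, rfl⟩ := mem_untimedLanguage.1 hw
  obtain ⟨y, hy, h⟩ := h.isPath_generator 0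
  exact ⟨_, (εNFA.mem_accepts_iff_exists_path _).2 ⟨_, q, y, rfl, hq, hy, h⟩, uword_perm x⟩

/-- Every sufficiently long word of an untimed ADB language can be shortened by a bounded number of
symbols, up to the order of the symbols. -/
theorem exists_perm_append_mem_untimedLanguage (A : ADB S Q) :
    ∃ C : ℕ, ∀ w ∈ A.untimedLanguage, C ≤ w.length →
      ∃ u v, w ~ u ++ v ∧ v ≠ [] ∧ v.length ≤ C ∧ ∃ w' ∈ A.untimedLanguage, w' ~ u := by
  classical
  have := A.finite_locations
  have := Fintype.ofFinite Q
  -- The pumping constant of an `εNFA` counts the states of its subset automaton.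
  refine ⟨Fintype.card (Set Q), fun w hw hlen => ?_⟩
  obtain ⟨y, hy, hp⟩ := exists_perm_mem_generator hw
  obtain ⟨a, b, c, rfl, hab, hb, h⟩ := A.generator.pumping_lemma hy (hp.length_eq ▸ hlen)
  refine ⟨a ++ c, b, hp.trans ?_, hb, by omega, exists_perm_mem_untimedLanguage (h ?_)⟩
  · rw [append_assoc, append_assoc]
    exact (perm_append_comm (l₁ := b)).append_left a
  -- The pumped factor is repeated zero times.
  · have := Language.append_mem_mul (Language.append_mem_mul (Set.mem_singleton a)
      (Language.nil_mem_kstar ({b} : Language S))) (Set.mem_singleton c)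
    rwa [append_nil] at this

/-! ### Repeated words are not an ADB language. -/

theorem untime_kappa (t : ℕ) (w : List S) : untime (kappa t w) = w := by
  simp [untime, kappa, Function.comp_def]

theorem untime_flatMap_kappa (n : ℕ) (w : List S) :
    untime ((range n).flatMap fun i => kappa i w) = (replicate n w).flatten := by
  have : untime ((range n).flatMap fun i => kappa i w) =
      (range n).flatMap fun i => untime (kappa i w) := map_flatMap ..
  rw [this, flatMap_def]
  simp [untime_kappa]

theorem mem_untimeLanguage_repeatedWords {a b h : S} {x : List S} :
    x ∈ untimeLanguage (repeatedWords a b h) ↔ ∃ (w : List S) (n : ℕ),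
      (∀ s ∈ w, s = a ∨ s = b) ∧ x = (replicate (n + 1) (w ++ [h])).flatten := by
  constructor
  · rintro ⟨_, ⟨w, n, hw, rfl⟩, rfl⟩
    exact ⟨w, n, hw, untime_flatMap_kappa _ _⟩
  · rintro ⟨w, n, hw, rfl⟩
    exact ⟨_, ⟨w, n, hw, rfl⟩, untime_flatMap_kappa _ _⟩

theorem length_flatten_replicate (n : ℕ) (w : List S) :
    (replicate n w).flatten.length = n * w.length := by
  simp

/-- Here `(C + 1)²` blocks of length `C + 1` lose `r` symbols, `j` of them separators, leaving `n`
blocks of length `k + 1`. Shorter blocks would cost at least `n` symbols, and `n > C`. Equal blocks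
force `r` to be a multiple of `C + 1`. Longer blocks need `n ≤ j * (C + 1)`, but `n > C * (C + 1)`.
-/
theorem no_shorter_product {C n k r j : ℕ} (hr : r ≤ C) (hj : j ≤ r) (hr₀ : 0 < r)
    (h : C * (C + 2) + 1 = n + j) (h' : (C * (C + 2) + 1) * (C + 1) = n * (k + 1) + r) :
    False := by
  have hC : C * (C + 2) = C * C + 2 * C := by ring
  rw [h, add_mul] at h'
  rcases lt_trichotomy k C with hk | rfl | hk
  · have h₁ : n * (k + 1) ≤ n * C := Nat.mul_le_mul_left n hk
    have h₂ : n * (C + 1) = n * C + n := by ring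
    have : n ≤ r := by omega
    have := Nat.zero_le (C * C)
    omega
  · have h₁ : j * (k + 1) = r := by omega
    rcases Nat.eq_zero_or_pos j with rfl | hj
    · omega
    · have := Nat.le_mul_of_pos_left (k + 1) hj
      omega
  · have h₁ : n * (C + 1 + 1) ≤ n * (k + 1) := Nat.mul_le_mul_left n (by omega)
    have h₂ : n * (C + 1 + 1) = n * (C + 1) + n := by ring
    have h₃ : j * (C + 1) ≤ C * (C + 1) := Nat.mul_le_mul_right _ (hj.trans hr)
    have h₄ : C * (C + 1) = C * C + C := by ring
    omega

/-- Only length and number of separators are used, as both survive permutation. -/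
theorem not_isUntimedADBLanguage_repeatedWords {a b h : S} (ha : a ≠ h) (hb : b ≠ h) :
    ¬ IsUntimedADBLanguage (untimeLanguage (repeatedWords a b h)) := by
  classical
  rintro ⟨Q, A, hA⟩
  obtain ⟨C, hC⟩ := A.exists_perm_append_mem_untimedLanguage
  rw [hA] at hC
  -- A block of length `C + 1` is too long to be removed whole, and `C * (C + 2) + 1 = (C + 1)²`
  -- copies are too many for all of them to change length.
  obtain ⟨u, v, hp, hv, hvC, _, hw', hpu⟩ :=
    hC _ (mem_untimeLanguage_repeatedWords.2 ⟨replicate C a, C * (C + 2), by simp, rfl⟩)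
      (by rw [length_flatten_replicate, length_append, length_replicate, length_singleton]
          nlinarith [Nat.zero_le (C * (C + 2) * (C + 1))])
  obtain ⟨w, n, hw, rfl⟩ := mem_untimeLanguage_repeatedWords.1 hw'
  have hcount : ∀ (n : ℕ) (w : List S), (∀ s ∈ w, s ≠ h) →
      ((replicate n (w ++ [h])).flatten).count h = n := by
    intro n w hw
    have : w.count h = 0 := count_eq_zero.2 fun hh => hw h hh rfl
    simp [count_flatten, this]
  have h₁ := hp.length_eq
  have h₂ := hpu.length_eq
  have h₃ := hp.count_eq h
  have h₄ := hpu.count_eq h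
  rw [length_append] at h₁
  rw [count_append, hcount _ _ (by simp +contextual [ha])] at h₃
  rw [hcount _ _ (by rintro s hs rfl; rcases hw _ hs with rfl | rfl <;> contradiction)] at h₄
  simp only [length_flatten_replicate, length_append, length_replicate, length_singleton] at h₁ h₂
  have h₅ := count_le_length (a := h) (l := v)
  have h₆ := length_pos_iff.2 hv
  rw [← h₂] at h₁
  rw [← h₄] at h₃
  exact no_shorter_product hvC h₅ h₆ h₃ h₁

/-! ### ADBs that generate paired blocks. -/

/-- The concatenation of the timed words `κ_t(w₀ h)`, `κ_{t+1}(w₁ h)`, … for a list of words over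
the symbols `f c`. -/
def blocks (f : Bool → S) (h : S) : ℕ → List (List Bool) → List (S × ℕ)
  | _, [] => []
  | t, w :: ws => kappa t (w.map f ++ [h]) ++ blocks f h (t + 1) ws

/-- The entries with indices `2 * i` and `2 * i + 1` agree, whenever both exist. -/
def Paired : List (List Bool) → Prop
  | v :: w :: ws => v = w ∧ Paired ws
  | _ => True

theorem eq_of_mem_kappa {t : ℕ} {w : List S} {u : S × ℕ} (hu : u ∈ kappa t w) : u.2 = t := by
  obtain ⟨s, _, rfl⟩ := mem_map.1 hu
  rfl

theorem le_of_mem_blocks {f : Bool → S} {h : S} {t : ℕ} {ws : List (List Bool)} {u : S × ℕ}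
    (hu : u ∈ blocks f h t ws) : t ≤ u.2 := by
  induction ws generalizing t with
  | nil => simp [blocks] at hu
  | cons w ws ih =>
    rcases mem_append.1 hu with hu | hu
    · exact (eq_of_mem_kappa hu).ge
    · exact (Nat.le_succ t).trans (ih hu)

/-- The locations of the ADBs that generate lists of blocks with two consecutive equal blocks. -/
inductive PairLocation
  | idle | pair | letter (c : Bool) | sep | wait | wait' | last | final | first | gap

open PairLocation

instance : Finite PairLocation := by
  refine Set.finite_univ_iff.1 ((Set.toFinite {idle, pair, letter true, letter false, sep, wait,
    wait', last, final, first, gap}).subset ?_)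
  rintro (_ | _ | (_ | _) | _ | _ | _ | _ | _ | _ | _) _ <;> simp

/-- The transitions of the ADBs that generate lists of blocks with two consecutive equal blocks:
from `pair` both copies of a block are generated simultaneously with delays `0` and `1`, from `first`
and from `last` a single block is generated. -/
inductive PairStep (f : Bool → S) (h : S) : PairLocation → DelayLabel S → PairLocation → Prop
  | toPair : PairStep f h idle .eps pair
  | toLast : PairStep f h idle .eps last
  | letter (c : Bool) : PairStep f h pair (.out (f c) 0) (letter c)
  | letter' (c : Bool) : PairStep f h (letter c) (.out (f c) 1) pair
  | sep : PairStep f h pair (.out h 0) sep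
  | sep' : PairStep f h sep (.out h 1) wait
  | wait : PairStep f h wait .tick wait'
  | wait' : PairStep f h wait' .tick idle
  | lastLetter (c : Bool) : PairStep f h last (.out (f c) 0) last
  | lastSep : PairStep f h last (.out h 0) final
  | firstLetter (c : Bool) : PairStep f h first (.out (f c) 0) first
  | firstSep : PairStep f h first (.out h 0) gap
  | gap : PairStep f h gap .tick idle

/-- The ADB that generates lists of blocks with two consecutive equal blocks, starting at `q`. -/
def pairADB (f : Bool → S) (h : S) (q : PairLocation) : ADB S PairLocation where
  finite_locations := inferInstance
  delays := {0, 1}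
  start := q
  accept := {idle, final}
  step p l := {p' | PairStep f h p l p'}
  delay_mem := by
    rintro p s t p' h
    cases h <;> simp

/-- The timed words generated from a location of `pairADB`, depending on the time. -/
def PairOutput (f : Bool → S) (h : S) : PairLocation → (ℕ → List (S × ℕ)) → Prop
  | idle, o => ∃ ws, Paired ws ∧ ∀ t, o t = blocks f h t ws
  | pair, o => ∃ (w : List Bool) (ws : _), Paired ws ∧ ∀ t, o t =
      kappa t (w.map f ++ [h]) ++ (kappa (t + 1) (w.map f ++ [h]) ++ blocks f h (t + 2) ws)
  | letter c, o => ∃ (w : List Bool) (ws : _), Paired ws ∧ ∀ t, o t =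
      kappa t (w.map f ++ [h]) ++ (kappa (t + 1) (f c :: (w.map f ++ [h])) ++ blocks f h (t + 2) ws)
  | sep, o => ∃ ws, Paired ws ∧ ∀ t, o t = kappa (t + 1) [h] ++ blocks f h (t + 2) ws
  | wait, o => ∃ ws, Paired ws ∧ ∀ t, o t = blocks f h (t + 2) ws
  | wait', o => ∃ ws, Paired ws ∧ ∀ t, o t = blocks f h (t + 1) ws
  | last, o => ∃ w : List Bool, ∀ t, o t = kappa t (w.map f ++ [h])
  | final, o => ∀ t, o t = []
  | first, o => ∃ w ws, Paired ws ∧ ∀ t, o t = blocks f h t (w :: ws)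
  | gap, o => ∃ ws, Paired ws ∧ ∀ t, o t = blocks f h (t + 1) ws

theorem owordFrom_out_zero {s : S} {t : ℕ} {x : List (DelayLabel S)} :
    owordFrom t (.out s 0 :: x) = (s, t) :: owordFrom t x :=
  insertionSort_cons_of_forall_rel _ fun _ hu => le_of_mem_stamp hu

/-- A delay of 1 puts the symbol behind everything stamped `t`, but in front of later-generated
symbols stamped `t + 1`. Thus it extends the second copy of a block on the left. -/
theorem owordFrom_out_one {s : S} {t : ℕ} {x : List (DelayLabel S)} {w : List S} {l : List (S × ℕ)}
    (h : owordFrom t x = kappa t w ++ l) (hl : ∀ u ∈ l, t + 1 ≤ u.2) :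
    owordFrom t (.out s 1 :: x) = kappa t w ++ (s, t + 1) :: l := by
  have h₁ : owordFrom t (.out s 1 :: x) =
      (owordFrom t x).orderedInsert (fun u v => u.2 ≤ v.2) (s, t + 1) := rfl
  have h₂ : l.orderedInsert (fun u v => u.2 ≤ v.2) (s, t + 1) = (s, t + 1) :: l :=
    orderedInsert_append_of_le (k := []) hl
  rw [h₁, h, orderedInsert_append_of_lt, h₂]
  intro u hu
  rw [eq_of_mem_kappa hu]
  exact t.lt_succ_self

theorem le_of_mem_kappa_append_blocks {f : Bool → S} {h : S} {t : ℕ} {w : List S}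
    {ws : List (List Bool)} : ∀ u ∈ kappa (t + 1) w ++ blocks f h (t + 2) ws, t + 1 ≤ u.2 := by
  intro u hu
  rcases mem_append.1 hu with hu | hu
  · exact (eq_of_mem_kappa hu).ge
  · exact (Nat.le_succ _).trans (le_of_mem_blocks hu)

/-- The output is treated as a function of the starting time, so that the induction hypothesis can
be used after a tick. -/
theorem pairOutput_of_run {f : Bool → S} {h : S} {q₀ p q : PairLocation} {x : List (DelayLabel S)}
    (hr : (pairADB f h q₀).Run p x q) (hq : q ∈ (pairADB f h q₀).accept) :
    PairOutput f h p fun t => owordFrom t x := by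
  induction hr with
  | nil =>
    rcases hq with rfl | rfl
    · exact ⟨[], trivial, fun t => rfl⟩
    · exact fun t => rfl
  | cons hs _ ih =>
    have ih := ih hq
    cases hs with
    | toPair =>
      obtain ⟨w, ws, hw, ih⟩ := ih
      exact ⟨w :: w :: ws, ⟨rfl, hw⟩, fun t => (ih t).trans (by simp [blocks])⟩
    | toLast =>
      obtain ⟨w, ih⟩ := ih
      exact ⟨[w], trivial, fun t => (ih t).trans (by simp [blocks])⟩
    | letter c =>
      obtain ⟨w, ws, hw, ih⟩ := ih
      exact ⟨c :: w, ws, hw, fun t => owordFrom_out_zero.trans (congrArg _ (ih t))⟩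
    | letter' c =>
      obtain ⟨w, ws, hw, ih⟩ := ih
      exact ⟨w, ws, hw, fun t => owordFrom_out_one (ih t) le_of_mem_kappa_append_blocks⟩
    | sep =>
      obtain ⟨ws, hw, ih⟩ := ih
      exact ⟨[], ws, hw, fun t => owordFrom_out_zero.trans (congrArg _ (ih t))⟩
    | sep' =>
      obtain ⟨ws, hw, ih⟩ := ih
      exact ⟨ws, hw, fun t => owordFrom_out_one (w := []) (ih t)
        fun u hu => (Nat.le_succ _).trans (le_of_mem_blocks hu)⟩
    | wait =>
      obtain ⟨ws, hw, ih⟩ := ih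
      exact ⟨ws, hw, fun t => ih (t + 1)⟩
    | wait' =>
      obtain ⟨ws, hw, ih⟩ := ih
      exact ⟨ws, hw, fun t => ih (t + 1)⟩
    | lastLetter c =>
      obtain ⟨w, ih⟩ := ih
      exact ⟨c :: w, fun t => owordFrom_out_zero.trans (congrArg _ (ih t))⟩
    | lastSep => exact ⟨[], fun t => owordFrom_out_zero.trans (congrArg _ (ih t))⟩
    | firstLetter c =>
      obtain ⟨w, ws, hw, ih⟩ := ih
      exact ⟨c :: w, ws, hw, fun t => owordFrom_out_zero.trans (congrArg _ (ih t))⟩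
    | firstSep =>
      obtain ⟨ws, hw, ih⟩ := ih
      exact ⟨[], ws, hw, fun t => owordFrom_out_zero.trans (congrArg _ (ih t))⟩
    | gap =>
      obtain ⟨ws, hw, ih⟩ := ih
      exact ⟨ws, hw, fun t => ih (t + 1)⟩

/-- A run of `pairADB` through a word of simultaneously generated letters. -/
theorem exists_run_pair {f : Bool → S} {h : S} {q₀ q : PairLocation} {x : List (DelayLabel S)}
    (hr : (pairADB f h q₀).Run idle x q) {ws : List (List Bool)}
    (hx : ∀ t, owordFrom t x = blocks f h t ws) (w : List Bool) :
    ∃ y, (pairADB f h q₀).Run pair y q ∧ ∀ t, owordFrom t y =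
      kappa t (w.map f ++ [h]) ++ (kappa (t + 1) (w.map f ++ [h]) ++ blocks f h (t + 2) ws) := by
  induction w with
  | nil =>
    -- Two ticks, because the pair occupies times `t` and `t + 1`.
    refine ⟨.out h 0 :: .out h 1 :: .tick :: .tick :: x, .cons PairStep.sep (.cons PairStep.sep'
      (.cons PairStep.wait (.cons PairStep.wait' hr))), fun t => ?_⟩
    have hx' : owordFrom t (.tick :: .tick :: x) = kappa t [] ++ blocks f h (t + 2) ws := hx (t + 2)
    rw [owordFrom_out_zero, owordFrom_out_one hx'
      fun u hu => (Nat.le_succ _).trans (le_of_mem_blocks hu)]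
    rfl
  | cons c w ih =>
    obtain ⟨y, hr, hy⟩ := ih
    refine ⟨.out (f c) 0 :: .out (f c) 1 :: y,
      .cons (PairStep.letter c) (.cons (PairStep.letter' c) hr), fun t => ?_⟩
    rw [owordFrom_out_zero, owordFrom_out_one (hy t) le_of_mem_kappa_append_blocks]
    rfl

theorem exists_run_last {f : Bool → S} {h : S} {q₀ : PairLocation} (w : List Bool) :
    ∃ y, (pairADB f h q₀).Run last y final ∧ ∀ t, owordFrom t y = kappa t (w.map f ++ [h]) := by
  induction w with
  | nil =>
    exact ⟨[.out h 0], .cons PairStep.lastSep (.nil _), fun t => rfl⟩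
  | cons c w ih =>
    obtain ⟨y, hr, hy⟩ := ih
    exact ⟨_, .cons (PairStep.lastLetter c) hr, fun t => owordFrom_out_zero.trans (congrArg _ (hy t))⟩

theorem exists_run_first {f : Bool → S} {h : S} {q₀ q : PairLocation} {x : List (DelayLabel S)}
    (hr : (pairADB f h q₀).Run idle x q) {ws : List (List Bool)}
    (hx : ∀ t, owordFrom t x = blocks f h t ws) (w : List Bool) :
    ∃ y, (pairADB f h q₀).Run first y q ∧ ∀ t, owordFrom t y = blocks f h t (w :: ws) := by
  induction w with
  | nil =>
    refine ⟨.out h 0 :: .tick :: x, .cons PairStep.firstSep (.cons PairStep.gap hr), fun t => ?_⟩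
    have := hx (t + 1)
    rw [owordFrom_out_zero]
    exact congrArg _ this
  | cons c w ih =>
    obtain ⟨y, hr, hy⟩ := ih
    exact ⟨_, .cons (PairStep.firstLetter c) hr, fun t => owordFrom_out_zero.trans (congrArg _ (hy t))⟩

theorem exists_run_idle (f : Bool → S) (h : S) (q₀ : PairLocation) : ∀ ws, Paired ws →
    ∃ x, ∃ q ∈ (pairADB f h q₀).accept, (pairADB f h q₀).Run idle x q ∧
      ∀ t, owordFrom t x = blocks f h t ws
  | [], _ => ⟨[], idle, Or.inl rfl, .nil _, fun _ => rfl⟩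
  | [w], _ => by
    obtain ⟨y, hr, hy⟩ := exists_run_last (f := f) (h := h) (q₀ := q₀) w
    exact ⟨_, final, Or.inr rfl, .cons PairStep.toLast hr,
      fun t => (hy t).trans (by simp [blocks])⟩
  | _ :: w :: ws, ⟨rfl, hw⟩ => by
    obtain ⟨x, q, hq, hr, hx⟩ := exists_run_idle f h q₀ ws hw
    obtain ⟨y, hr, hy⟩ := exists_run_pair hr hx w
    exact ⟨_, q, hq, .cons PairStep.toPair hr, fun t => (hy t).trans (by simp [blocks])⟩

theorem timedLanguage_pairADB_idle (f : Bool → S) (h : S) :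
    (pairADB f h idle).timedLanguage = blocks f h 0 '' {ws | Paired ws} := by
  ext v
  constructor
  · rintro ⟨x, q, hq, hr, rfl⟩
    obtain ⟨ws, hw, hx⟩ := pairOutput_of_run hr hq
    exact ⟨ws, hw, (hx 0).symm⟩
  · rintro ⟨ws, hw, rfl⟩
    obtain ⟨x, q, hq, hr, hx⟩ := exists_run_idle f h idle ws hw
    exact ⟨x, q, hq, hr, hx 0⟩

theorem timedLanguage_pairADB_first (f : Bool → S) (h : S) :
    (pairADB f h first).timedLanguage = blocks f h 0 '' {ws | ws ≠ [] ∧ Paired ws.tail} := by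
  ext v
  constructor
  · rintro ⟨x, q, hq, hr, rfl⟩
    obtain ⟨w, ws, hw, hx⟩ := pairOutput_of_run hr hq
    exact ⟨w :: ws, ⟨by simp, hw⟩, (hx 0).symm⟩
  · rintro ⟨_ | ⟨w, ws⟩, ⟨hne, hw⟩, rfl⟩
    · exact absurd rfl hne
    · obtain ⟨x, q, hq, hr, hx⟩ := exists_run_idle f h first ws hw
      obtain ⟨y, hr, hy⟩ := exists_run_first hr hx w
      exact ⟨y, q, hq, hr, hy 0⟩

/-! ### Repeated words as an intersection. -/

/-- The separator is no letter, so it marks where each block ends and the list can be read off.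
Consequently taking images commutes with intersection, even after the stamps are erased. -/
theorem untime_blocks_injective {f : Bool → S} (hf : f.Injective) {h : S} (hh : ∀ c, f c ≠ h)
    (t : ℕ) : (fun ws => untime (blocks f h t ws)).Injective := by
  have hcons : ∀ t w ws, untime (blocks f h t (w :: ws)) =
      w.map f ++ h :: untime (blocks f h (t + 1) ws) := fun t w ws => by
    rw [blocks, untime_append, untime_kappa, append_assoc]
    rfl
  have key : ∀ (v w : List Bool) (x y : List S), v.map f ++ h :: x = w.map f ++ h :: y →
      v = w ∧ x = y := by
    intro v
    induction v with
    | nil =>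
      rintro (_ | ⟨c, w⟩) x y e
      · exact ⟨rfl, (cons_inj_right h).1 e⟩
      · exact absurd (cons.inj e).1.symm (hh c)
    | cons b v ih =>
      rintro (_ | ⟨c, w⟩) x y e
      · exact absurd (cons.inj e).1 (hh b)
      · obtain ⟨rfl, rfl⟩ := ih _ _ _ (cons.inj e).2
        exact ⟨by rw [hf (cons.inj e).1], rfl⟩
  intro vs ws e
  simp only at e
  induction vs generalizing t ws with
  | nil =>
    cases ws with
    | nil => rfl
    | cons w ws => rw [hcons] at e; simp [blocks, untime] at e
  | cons v vs ih =>
    cases ws with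
    | nil => rw [hcons] at e; simp [blocks, untime] at e
    | cons w ws =>
      rw [hcons, hcons] at e
      obtain ⟨rfl, e'⟩ := key _ _ _ _ e
      rw [ih _ e']

theorem paired_and_paired_tail_iff {ws : List (List Bool)} :
    (Paired ws ∧ ws ≠ [] ∧ Paired ws.tail) ↔ ∃ w n, ws = replicate (n + 1) w := by
  constructor
  · rintro ⟨h₁, hne, h₂⟩
    obtain ⟨w, ws, rfl⟩ := exists_cons_of_ne_nil hne
    refine ⟨w, ws.length, ?_⟩
    rw [tail_cons] at h₂
    clear hne
    induction ws generalizing w with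
    | nil => rfl
    | cons v ws ih =>
      obtain ⟨rfl, h₁⟩ := h₁
      -- Dropping the first block exchanges the roles of the two pairings.
      rw [length_cons, replicate_succ, ← ih w h₂ h₁]
  · rintro ⟨w, n, rfl⟩
    have : ∀ n, Paired (replicate n w) ∧ Paired (replicate (n + 1) w) := by
      intro n
      induction n with
      | zero => exact ⟨trivial, trivial⟩
      | succ n ih => exact ⟨ih.2, rfl, ih.1⟩
    exact ⟨(this n).2, by simp, (this n).1⟩

theorem blocks_replicate (f : Bool → S) (h : S) (t n : ℕ) (w : List Bool) :
    blocks f h t (replicate n w) =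
      (range n).flatMap fun i => kappa (t + i) (w.map f ++ [h]) := by
  induction n generalizing t with
  | zero => rfl
  | succ n ih =>
    rw [replicate_succ, blocks, ih, range_succ_eq_map, flatMap_cons, flatMap_map]
    simp [Nat.add_comm, Nat.add_left_comm]

theorem repeatedWords_eq_image (a b h : S) :
    repeatedWords a b h = blocks (fun c => if c then a else b) h 0 ''
      {ws | Paired ws ∧ ws ≠ [] ∧ Paired ws.tail} := by
  have hmap : ∀ v : List S, (∀ s ∈ v, s = a ∨ s = b) ↔
      ∃ w : List Bool, w.map (fun c => if c then a else b) = v := by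
    intro v
    constructor
    · intro hv
      induction v with
      | nil => exact ⟨[], rfl⟩
      | cons s v ih =>
        obtain ⟨w, rfl⟩ := ih fun s hs => hv s (by simp [hs])
        rcases hv s (by simp) with rfl | rfl
        · exact ⟨true :: w, by simp⟩
        · exact ⟨false :: w, by simp⟩
    · rintro ⟨w, rfl⟩ s hs
      obtain ⟨c, _, rfl⟩ := mem_map.1 hs
      cases c <;> simp
  ext x
  constructor
  · rintro ⟨v, n, hv, rfl⟩
    obtain ⟨w, rfl⟩ := (hmap v).1 hv
    exact ⟨replicate (n + 1) w, paired_and_paired_tail_iff.2 ⟨w, n, rfl⟩, by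
      simp [blocks_replicate]⟩
  · rintro ⟨ws, hws, rfl⟩
    obtain ⟨w, n, rfl⟩ := paired_and_paired_tail_iff.1 hws
    exact ⟨_, n, (hmap _).2 ⟨w, rfl⟩, by simp [blocks_replicate]⟩

theorem timedLanguage_inter_eq_repeatedWords {a b h : S} (hab : a ≠ b) (ha : a ≠ h) (hb : b ≠ h) :
    let f : Bool → S := fun c => if c then a else b
    (pairADB f h idle).timedLanguage ∩ (pairADB f h first).timedLanguage = repeatedWords a b h ∧
    (pairADB f h idle).untimedLanguage ⊓ (pairADB f h first).untimedLanguage =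
      untimeLanguage (repeatedWords a b h) := by
  intro f
  have hf : f.Injective := by
    rintro (_ | _) (_ | _) e <;> simp_all [f, eq_comm]
  have hinj := untime_blocks_injective hf (h := h) (by rintro (_ | _) <;> simpa [f]) 0
  rw [untimedLanguage, untimedLanguage, untimeLanguage, untimeLanguage, untimeLanguage,
    repeatedWords_eq_image, timedLanguage_pairADB_idle, timedLanguage_pairADB_first]
  constructor
  · exact (Set.image_inter (f := blocks f h 0) hinj.of_comp).symm
  · simp only [Set.image_image]
    exact (Set.image_inter hinj).symm

end ADB

/-! ### The closure properties. -/

theorem isUntimedADBLanguage_add {S : Type*} {L₁ L₂ : Language S} :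
    IsUntimedADBLanguage L₁ → IsUntimedADBLanguage L₂ → IsUntimedADBLanguage (L₁ + L₂) := by
  rintro ⟨Q₁, A₁, rfl⟩ ⟨Q₂, A₂, rfl⟩
  exact ⟨_, _, A₁.untimedLanguage_union A₂⟩

theorem mainTheorem5 {S : Type*} :
    -- union
    (∀ L₁ L₂ : Language S, IsUntimedADBLanguage L₁ → IsUntimedADBLanguage L₂ →
      IsUntimedADBLanguage (L₁ + L₂)) ∧
    -- concatenation, realized with padding ticks
    (∀ L₁ L₂ : Language S, IsUntimedADBLanguage L₁ → IsUntimedADBLanguage L₂ →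
      IsUntimedADBLanguage (L₁ * L₂)) ∧
    (∀ (Q₁ Q₂ : Type) (A₁ : ADB S Q₁) (A₂ : ADB S Q₂),
      (A₁.concat A₂).untimedLanguage = A₁.untimedLanguage * A₂.untimedLanguage) ∧
    -- Kleene star, realized with padding ticks
    (∀ L : Language S, IsUntimedADBLanguage L → IsUntimedADBLanguage (KStar.kstar L)) ∧
    (∀ (Q : Type) (A : ADB S Q), A.star.untimedLanguage = KStar.kstar A.untimedLanguage) ∧
    -- intersection with regular languages
    (∀ L R : Language S, IsUntimedADBLanguage L → R.IsRegular →
      IsUntimedADBLanguage (L ⊓ R)) ∧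
    -- over every alphabet with three different symbols
    (∀ a b h : S, a ≠ b → a ≠ h → b ≠ h →
      -- the repeated-word language, timed and untimed, is not an ADB language
      ¬ IsTimedADBLanguage (ADB.repeatedWords a b h) ∧
      ¬ IsUntimedADBLanguage (ADB.untimeLanguage (ADB.repeatedWords a b h)) ∧
      -- but it is the intersection of two ADB languages
      (∃ (Q₁ Q₂ : Type) (A₁ : ADB S Q₁) (A₂ : ADB S Q₂),
        A₁.timedLanguage ∩ A₂.timedLanguage = ADB.repeatedWords a b h ∧
        A₁.untimedLanguage ⊓ A₂.untimedLanguage =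
          ADB.untimeLanguage (ADB.repeatedWords a b h)) ∧
      -- no closure under intersection
      (¬ ∀ L₁ L₂ : Language S, IsUntimedADBLanguage L₁ → IsUntimedADBLanguage L₂ →
        IsUntimedADBLanguage (L₁ ⊓ L₂)) ∧
      -- no closure under complementation
      (¬ ∀ L : Language S, IsUntimedADBLanguage L → IsUntimedADBLanguage Lᶜ)) := by
  refine ⟨fun _ _ => isUntimedADBLanguage_add, ?_,
    fun _ _ A₁ A₂ => A₁.untimedLanguage_concat A₂, ?_, fun _ A => A.untimedLanguage_star, ?_, ?_⟩
  · rintro _ _ ⟨Q₁, A₁, rfl⟩ ⟨Q₂, A₂, rfl⟩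
    exact ⟨_, _, A₁.untimedLanguage_concat A₂⟩
  · rintro _ ⟨Q, A, rfl⟩
    exact ⟨_, _, A.untimedLanguage_star⟩
  · rintro _ _ ⟨Q, A, rfl⟩ ⟨σ, _, D, rfl⟩
    exact ⟨_, _, A.untimedLanguage_inter D⟩
  · intro a b h hab ha hb
    have hU := ADB.not_isUntimedADBLanguage_repeatedWords ha hb
    have hinter := ADB.timedLanguage_inter_eq_repeatedWords hab ha hb
    have hnot : ¬ ∀ L₁ L₂ : Language S, IsUntimedADBLanguage L₁ → IsUntimedADBLanguage L₂ →
        IsUntimedADBLanguage (L₁ ⊓ L₂) :=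
      fun H => hU (hinter.2 ▸ H _ _ ⟨_, _, rfl⟩ ⟨_, _, rfl⟩)
    refine ⟨?_, hU, ⟨_, _, _, _, hinter⟩, hnot, fun H => hnot fun L₁ L₂ h₁ h₂ => ?_⟩
    · rintro ⟨Q, A, hA⟩
      exact hU ⟨Q, A, congrArg ADB.untimeLanguage hA⟩
    · have : L₁ ⊓ L₂ = (L₁ᶜ + L₂ᶜ)ᶜ := by
        ext x
        exact (not_or.trans (and_congr not_not not_not)).symm
      rw [this]
      exact H _ (isUntimedADBLanguage_add (H _ h₁) (H _ h₂))
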